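/- Let $M\in\mathbb{R}^{m\times m}$ be symmetric positive definite, let $U:\mathbb{R}^m\to\mathbb{R}$ and $g:\mathbb{R}^m\to\mathbb{R}^\nu$ be (real) analytic, let $\nabla g(q)\in\mathbb{R}^{m\times\nu}$ denote the transposed Jacobian matrix of $g$, and let $H(q,p)=\tfrac12 p^\top M^{-1}p+U(q)$. Let $(q_0,p_0)\in\mathbb{R}^m\times\mathbb{R}^m$ satisfy $g(q_0)=0$ and $\nabla g(q_0)^\top M^{-1}p_0=0$, and suppose that $\nabla g(q_0)^\top M^{-1}\nabla g(q_0)$ is nonsingular. Put $$\lambda(q_0,p_0)=\left[\nabla g(q_0)^\top M^{-1}\nabla g(q_0)\right]^{-1}\left[\nabla^2 g(q_0)(M^{-1}p_0,M^{-1}p_0)-\nabla g(q_0)^\top M^{-1}\nabla U(q_0)\right].$$ For $h>0$ and a constant vector $\lambda_0\in\mathbb{R}^\nu$ consider the local problem $$\dot u=M^{-1}v,\qquad \dot v=-\nabla U(u)-\nabla g(u)\lambda_0,\qquad t\in[0,h],\qquad u(0)=q_0,\quad v(0)=p_0,$$ and, if it has a solution on $[0,h]$, set $q_1=u(h)$ and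 $p_1=v(h)$. Then for all sufficiently small $h>0$ there is a vector $\lambda_0=\lambda_0(h)\in\mathbb{R}^\nu$ such that the local problem has a solution on $[0,h]$ with $g(q_1)=0$ and, therefore, $H(q_1,p_1)=H(q_0,p_0)$, and such that, as $h\to0^+$: 1. $\lambda_0=\lambda(q_0,p_0)+O(h)$; 2. $q_1-q(h)=O(h^2)$ and $p_1-p(h)=O(h^2)$, whenever $(q,p)$ is, with some multiplier function $\lambda:[0,T]\to\mathbb{R}^\nu$ and some $T>0$, a solution on $[0,T]$ of the constrained problem $\dot q=M^{-1}p$, $\dot p=-\nabla U(q)-\nabla g(q)\lambda(t)$, $g(q)=0$, $q(0)=q_0$, $p(0)=p_0$; 3. $\nabla g(q_1)^\top M^{-1}p_1=O(h^2)$. This $\lambda_0$ is unique in the following sense: for every $R>0$ and all sufficiently small $h>0$ (depending on $R$), $\lambda_0(h)$ is the only vector $\lambda_0\in\mathbb{R}^\nu$ with $\|\lambda_0\|\le R$ for which the local problem has a solution on $[0,h]$ with $g(q_1)=0$, and the resulting $(q_1,p_1)$ is unique. In particular, any two families $\lambda_0(h)$ with $g(q_1)=0$ and $\lambda_0(h)=\lambda(q_0,p_0)+O(h)$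 coincide for all sufficiently small $h>0$. -/

import Mathlib

open Set Filter Topology Asymptotics
open scoped Matrix

noncomputable section

namespace HolonomicLIM

/-- The separable Hamiltonian `H(q,p) = (1/2) pᵀ M⁻¹ p + U(q)`. -/
def hamiltonian {m : ℕ} (M : Matrix (Fin m) (Fin m) ℝ) (U : (Fin m → ℝ) → ℝ)
    (q p : Fin m → ℝ) : ℝ :=
  1 / 2 * (p ⬝ᵥ (M⁻¹ *ᵥ p)) + U q

/-- The gradient of a scalar function on `ℝ^m`, as the vector of its partial derivatives. -/
def grad {m : ℕ} (U : (Fin m → ℝ) → ℝ) (q : Fin m → ℝ) : Fin m → ℝ :=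
  fun i => fderiv ℝ U q (Pi.single i 1)

/-- The matrix `∇g(q) ∈ ℝ^{m × ν}`, with entry `∂g_j/∂q_i` at position `(i, j)`
(the transpose of the Jacobian matrix). -/
def gradMat {m ν : ℕ} (g : (Fin m → ℝ) → (Fin ν → ℝ)) (q : Fin m → ℝ) :
    Matrix (Fin m) (Fin ν) ℝ :=
  Matrix.of fun i j => fderiv ℝ g q (Pi.single i 1) j

/-- The second derivative `∇²g(q)(x, y) ∈ ℝ^ν`. -/
def hess {m ν : ℕ} (g : (Fin m → ℝ) → (Fin ν → ℝ)) (q x y : Fin m → ℝ) : Fin ν → ℝ :=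
  fderiv ℝ (fderiv ℝ g) q x y

/-- The matrix `∇g(q)ᵀ M⁻¹ ∇g(q) ∈ ℝ^{ν × ν}`. -/
def gramMat {m ν : ℕ} (M : Matrix (Fin m) (Fin m) ℝ) (g : (Fin m → ℝ) → (Fin ν → ℝ))
    (q : Fin m → ℝ) : Matrix (Fin ν) (Fin ν) ℝ :=
  (gradMat g q)ᵀ * M⁻¹ * gradMat g q

/-- The residual `∇g(q)ᵀ M⁻¹ p ∈ ℝ^ν` of the hidden constraint. -/
def hidden {m ν : ℕ} (M : Matrix (Fin m) (Fin m) ℝ) (g : (Fin m → ℝ) → (Fin ν → ℝ))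
    (q p : Fin m → ℝ) : Fin ν → ℝ :=
  (gradMat g q)ᵀ *ᵥ (M⁻¹ *ᵥ p)

/-- The multiplier as a function of the state,
`λ(q,p) = [∇g(q)ᵀ M⁻¹ ∇g(q)]⁻¹ [∇²g(q)(M⁻¹p, M⁻¹p) - ∇g(q)ᵀ M⁻¹ ∇U(q)]`. -/
def multiplier {m ν : ℕ} (M : Matrix (Fin m) (Fin m) ℝ) (U : (Fin m → ℝ) → ℝ)
    (g : (Fin m → ℝ) → (Fin ν → ℝ)) (q p : Fin m → ℝ) : Fin ν → ℝ :=
  (gramMat M g q)⁻¹ *ᵥ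
    (hess g q (M⁻¹ *ᵥ p) (M⁻¹ *ᵥ p) - (gradMat g q)ᵀ *ᵥ (M⁻¹ *ᵥ grad U q))

/-- `(x, y)` solves, on `[0, T]`, the equations
`x' = M⁻¹ y`, `y' = -∇U(x) - ∇g(x) Λ(t)`, `x(0) = q₀`, `y(0) = p₀`. -/
structure IsMotion {m ν : ℕ} (M : Matrix (Fin m) (Fin m) ℝ) (U : (Fin m → ℝ) → ℝ)
    (g : (Fin m → ℝ) → (Fin ν → ℝ)) (q₀ p₀ : Fin m → ℝ) (T : ℝ)
    (Λ : ℝ → (Fin ν → ℝ)) (x y : ℝ → (Fin m → ℝ)) : Prop where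
  init_pos : x 0 = q₀
  init_mom : y 0 = p₀
  deriv_pos : ∀ t ∈ Icc (0 : ℝ) T, HasDerivWithinAt x (M⁻¹ *ᵥ y t) (Icc 0 T) t
  deriv_mom : ∀ t ∈ Icc (0 : ℝ) T,
    HasDerivWithinAt y (-grad U (x t) - gradMat g (x t) *ᵥ Λ t) (Icc 0 T) t

/-- `(q, p)`, with multiplier function `Λ`, solves the constrained Hamiltonian problem on
`[0, T]`: the equations of motion and the constraint `g(q(t)) = 0`. -/
structure IsConstrainedMotion {m ν : ℕ} (M : Matrix (Fin m) (Fin m) ℝ)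
    (U : (Fin m → ℝ) → ℝ) (g : (Fin m → ℝ) → (Fin ν → ℝ)) (q₀ p₀ : Fin m → ℝ) (T : ℝ)
    (Λ : ℝ → (Fin ν → ℝ)) (q p : ℝ → (Fin m → ℝ)) : Prop where
  motion : IsMotion M U g q₀ p₀ T Λ q p
  constraint : ∀ t ∈ Icc (0 : ℝ) T, g (q t) = 0

/-- `(q₁, p₁) = (u(h), v(h))`, where `(u, v)` solves the local problem on `[0, h]` with the
constant multiplier `l`. -/
def IsOneStep {m ν : ℕ} (M : Matrix (Fin m) (Fin m) ℝ) (U : (Fin m → ℝ) → ℝ)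
    (g : (Fin m → ℝ) → (Fin ν → ℝ)) (q₀ p₀ : Fin m → ℝ) (h : ℝ) (l : Fin ν → ℝ)
    (q₁ p₁ : Fin m → ℝ) : Prop :=
  ∃ u v : ℝ → (Fin m → ℝ),
    IsMotion M U g q₀ p₀ h (fun _ => l) u v ∧ u h = q₁ ∧ v h = p₁

end HolonomicLIM

end

/-! Along a motion with constant multiplier `l`, the first and second time derivatives of `g` are
`hidden` and `accel`, and `accel` is affine in `l` with linear part `-gramMat`. Since `g` and
`hidden` vanish initially, g(u(h)) = (h²/2) accel(q₀,p₀,l) + O(h³). The zero of the leading term is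
λ(q₀,p₀), so after scaling by 2/h² the equation for `l` is an O(h) perturbation of an invertible
affine one.

The perturbation must also be O(h) in the Lipschitz sense in `l` (`constraint_sub_le` in
`IsLocalFlow`). To obtain this without differentiating the flow, `field` carries `l` as a constant
component of the state, so dependence on `l` is dependence on the initial value. The simplified
Newton map then has Lipschitz constant O(h) on bounded sets and moves λ(q₀,p₀) by O(h). Banach's
theorem gives existence and the O(h) estimate (`IsLocalFlow.exists_multiplier`); the contraction
estimate gives uniqueness (`IsLocalFlow.multiplier_unique`).

Energy is preserved because H + g·l is conserved and g vanishes at both ends. For the one-step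
errors, the step and the constrained solution have the same expansion to first order in h. The
multiplier Λ of the latter has no assumed regularity, but differentiating the constraint twice
forces Λ(t) = λ(q₀,p₀) + O(t) (`IsConstrainedMotion.multiplier_isBigO`). -/

noncomputable section

namespace HolonomicLIM


/-! ### Mean value estimates and integral curves of C¹ fields. -/

section Calculus

variable {E F : Type*} [NormedAddCommGroup E] [NormedSpace ℝ E] [NormedAddCommGroup F]
  [NormedSpace ℝ F]

theorem exists_lipschitzOnWith_closedBall [FiniteDimensional ℝ E] {f : E → F}
    (hf : ContDiff ℝ 1 f) (r : ℝ) :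
    ∃ K, LipschitzOnWith K f (Metric.closedBall 0 r) := by
  have : ProperSpace E := FiniteDimensional.proper ℝ E
  exact LocallyLipschitzOn.exists_lipschitzOnWith_of_compact (isCompact_closedBall _ _)
    hf.locallyLipschitz.locallyLipschitzOn

/-- A bound on the derivative over `[0, T]` bounds the increment from `0`. -/
theorem norm_sub_le_of_hasDerivWithinAt {w w' : ℝ → F} {t C : ℝ}
    (hw : ∀ s ∈ Icc (0 : ℝ) t, HasDerivWithinAt w (w' s) (Icc 0 t) s)
    (hC : ∀ s ∈ Icc (0 : ℝ) t, ‖w' s‖ ≤ C) (ht : 0 ≤ t) : ‖w t - w 0‖ ≤ C * t := by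
  have := Convex.norm_image_sub_le_of_norm_hasDerivWithin_le hw hC (convex_Icc 0 t)
    (left_mem_Icc.2 ht) (right_mem_Icc.2 ht)
  simpa [Real.norm_eq_abs, abs_of_nonneg ht] using this

/-- The mean value inequality on [0,t] with the constant bound C tᵏ. The factor 1/(k+1) is lost, but
`w'` need not be integrable. -/
theorem norm_le_pow_of_hasDerivWithinAt {w w' : ℝ → F} {T C : ℝ} (k : ℕ) (hC : 0 ≤ C)
    (hw : ∀ s ∈ Icc (0 : ℝ) T, HasDerivWithinAt w (w' s) (Icc 0 T) s) (h0 : w 0 = 0)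
    (hb : ∀ s ∈ Icc (0 : ℝ) T, ‖w' s‖ ≤ C * s ^ k) {t : ℝ} (ht : t ∈ Icc (0 : ℝ) T) :
    ‖w t‖ ≤ C * t ^ (k + 1) := by
  have hsub : Icc (0 : ℝ) t ⊆ Icc 0 T := Icc_subset_Icc_right ht.2
  have := norm_sub_le_of_hasDerivWithinAt (w := w) (w' := w') (t := t) (C := C * t ^ k)
    (fun s hs => (hw s (hsub hs)).mono hsub)
    (fun s hs => (hb s (hsub hs)).trans
      (mul_le_mul_of_nonneg_left (pow_le_pow_left₀ hs.1 hs.2 k) hC)) ht.1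
  rw [h0, sub_zero] at this
  rwa [pow_succ, ← mul_assoc]

/-- A `C¹` autonomous field has solutions on a common time interval for all initial values in a
ball. -/
theorem exists_uniform_integralCurve [FiniteDimensional ℝ E] {f : E → E} (hf : ContDiff ℝ 1 f) {r : ℝ} (hr : 0 ≤ r) :
    ∃ ε > 0, ∀ x ∈ Metric.closedBall (0 : E) r, ∃ γ : ℝ → E, γ 0 = x ∧
      (∀ t, γ t ∈ Metric.closedBall (0 : E) (r + 1)) ∧
      ∀ t ∈ Icc (0 : ℝ) ε, HasDerivWithinAt γ (f (γ t)) (Icc 0 ε) t := by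
  have : CompleteSpace E := FiniteDimensional.complete ℝ E
  have : ProperSpace E := FiniteDimensional.proper ℝ E
  obtain ⟨K, hK⟩ := exists_lipschitzOnWith_closedBall hf (r + 1)
  obtain ⟨B, hB⟩ := (isCompact_closedBall (0 : E) (r + 1)).exists_bound_of_continuousOn
    hf.continuous.continuousOn
  -- The added 1 keeps the speed bound positive; in time ε = 1/L a curve travels at most 1, so from
  -- radius r it stays within radius r + 1.
  set L : NNReal := Real.toNNReal B + 1 with hL
  have hLpos : (0 : ℝ) < L := by positivity
  set ε : ℝ := 1 / L with hε
  have hεpos : 0 < ε := by positivity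
  have h0 : (0 : ℝ) ∈ Icc 0 ε := ⟨le_rfl, hεpos.le⟩
  lift r to NNReal using hr
  have hPL : IsPicardLindelof (fun _ : ℝ => f) (tmin := 0) (tmax := ε) ⟨0, h0⟩ 0 (r + 1) r L K := by
    refine ⟨fun t _ => by simpa using hK, fun x _ => continuousOn_const, fun t _ x hx => ?_, ?_⟩
    · refine (hB x (by simpa using hx)).trans ((Real.le_coe_toNNReal B).trans ?_)
      simp [hL]
    · have : (L : ℝ) * max (ε - 0) (0 - 0) = 1 := by
        rw [sub_zero, sub_zero, max_eq_left hεpos.le, hε]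
        field_simp
      simp only [NNReal.coe_add, NNReal.coe_one]
      rw [this]
      linarith
  refine ⟨ε, hεpos, fun x hx => ?_⟩
  -- Working with the Picard fixed point itself keeps the confinement to the ball; `compProj`
  -- freezes the curve outside [0,ε], so confinement holds for every t.
  obtain ⟨α, hα⟩ := ODE.FunSpace.exists_isFixedPt_next hPL hx
  have hmem : ∀ t, α.compProj t ∈ Metric.closedBall (0 : E) (r + 1 : NNReal) :=
    fun t => α.compProj_mem_closedBall hPL.mul_max_le
  have heq : ∀ t ∈ Icc (0 : ℝ) ε,
      α.compProj t = ODE.picard (fun _ => f) 0 x α.compProj t := by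
    intro t ht
    rw [ODE.FunSpace.compProj_of_mem ht]
    exact (ODE.FunSpace.isFixedPt_next_iff hPL hx).1 hα ⟨t, ht⟩
  refine ⟨α.compProj, ?_, fun t => by simpa using hmem t, fun t ht => ?_⟩
  · rw [heq 0 h0, ODE.picard_apply₀]
  · refine (ODE.hasDerivWithinAt_picard_Icc (u := univ) h0 ?_ α.continuous_compProj.continuousOn
      (fun _ _ => mem_univ _) x ht).congr (fun s hs => heq s hs) (heq t ht)
    exact (hf.continuous.comp continuous_snd).continuousOn

theorem HasDerivWithinAt.Ici_of_Icc {γ : ℝ → F} {v : F} {T t : ℝ}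
    (h : HasDerivWithinAt γ v (Icc 0 T) t) (ht : t ∈ Ico (0 : ℝ) T) :
    HasDerivWithinAt γ v (Ici t) t :=
  h.mono_of_mem_nhdsWithin (mem_of_superset (Icc_mem_nhdsGE ht.2) (Icc_subset_Icc_left ht.1))

/-- Integral curves of a `C¹` field with the same initial value coincide. -/
theorem integralCurve_eqOn [FiniteDimensional ℝ E] {f : E → E} (hf : ContDiff ℝ 1 f) {T : ℝ} {γ δ : ℝ → E}
    (hγ : ∀ t ∈ Icc (0 : ℝ) T, HasDerivWithinAt γ (f (γ t)) (Icc 0 T) t)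
    (hδ : ∀ t ∈ Icc (0 : ℝ) T, HasDerivWithinAt δ (f (δ t)) (Icc 0 T) t)
    (h0 : γ 0 = δ 0) : EqOn γ δ (Icc 0 T) := by
  have cγ : ContinuousOn γ (Icc 0 T) := fun t ht => (hγ t ht).continuousWithinAt
  have cδ : ContinuousOn δ (Icc 0 T) := fun t ht => (hδ t ht).continuousWithinAt
  obtain ⟨A, hA⟩ := isCompact_Icc.exists_bound_of_continuousOn cγ
  obtain ⟨B, hB⟩ := isCompact_Icc.exists_bound_of_continuousOn cδ
  obtain ⟨K, hK⟩ := exists_lipschitzOnWith_closedBall hf (max A B)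
  refine ODE_solution_unique_of_mem_Icc_right (v := fun _ => f)
    (s := fun _ => Metric.closedBall 0 (max A B)) (K := K) (fun _ _ => hK) cγ
    (fun t ht => HasDerivWithinAt.Ici_of_Icc (hγ t (Ico_subset_Icc_self ht)) ht)
    (fun t ht => ?_) cδ
    (fun t ht => HasDerivWithinAt.Ici_of_Icc (hδ t (Ico_subset_Icc_self ht)) ht)
    (fun t ht => ?_) h0
  · exact mem_closedBall_zero_iff.2 ((hA t (Ico_subset_Icc_self ht)).trans (le_max_left _ _))
  · exact mem_closedBall_zero_iff.2 ((hB t (Ico_subset_Icc_self ht)).trans (le_max_right _ _))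

/-- Integral curves depend Lipschitz continuously on the initial value. -/
theorem integralCurve_norm_sub_le {f : E → E} {K : NNReal} {s : Set E}
    (hK : LipschitzOnWith K f s) {T : ℝ} {γ δ : ℝ → E}
    (hγ : ∀ t ∈ Icc (0 : ℝ) T, HasDerivWithinAt γ (f (γ t)) (Icc 0 T) t)
    (hδ : ∀ t ∈ Icc (0 : ℝ) T, HasDerivWithinAt δ (f (δ t)) (Icc 0 T) t)
    (mγ : ∀ t, γ t ∈ s) (mδ : ∀ t, δ t ∈ s) {t : ℝ} (ht : t ∈ Icc (0 : ℝ) T) :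
    ‖γ t - δ t‖ ≤ Real.exp (K * T) * ‖γ 0 - δ 0‖ := by
  have := dist_le_of_trajectories_ODE_of_mem (v := fun _ => f) (s := fun _ => s) (K := K)
    (δ := dist (γ 0) (δ 0)) (fun _ _ => hK) (fun t ht => (hγ t ht).continuousWithinAt)
    (fun t ht => HasDerivWithinAt.Ici_of_Icc (hγ t (Ico_subset_Icc_self ht)) ht)
    (fun t _ => mγ t) (fun t ht => (hδ t ht).continuousWithinAt)
    (fun t ht => HasDerivWithinAt.Ici_of_Icc (hδ t (Ico_subset_Icc_self ht)) ht)
    (fun t _ => mδ t) le_rfl t ht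
  rw [dist_eq_norm, dist_eq_norm, mul_comm, sub_zero] at this
  refine this.trans (mul_le_mul_of_nonneg_right (Real.exp_le_exp.2 ?_) (norm_nonneg _))
  exact mul_le_mul_of_nonneg_left ht.2 K.2

end Calculus

/-! ### The acceleration of the constraint, smoothness of the data, and derivatives along motions.
-/

section

variable {m ν : ℕ}

theorem gradMat_transpose_mulVec (g : (Fin m → ℝ) → (Fin ν → ℝ)) (q w : Fin m → ℝ) :
    (gradMat g q)ᵀ *ᵥ w = fderiv ℝ g q w := by
  conv_rhs => rw [pi_eq_sum_univ' w, map_sum]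
  ext j
  simp only [Matrix.mulVec, dotProduct, gradMat, Matrix.transpose_apply, Matrix.of_apply,
    map_smul, Finset.sum_apply, Pi.smul_apply, smul_eq_mul]
  refine Finset.sum_congr rfl fun i _ => ?_
  rw [mul_comm]

theorem grad_dotProduct (U : (Fin m → ℝ) → ℝ) (q w : Fin m → ℝ) :
    grad U q ⬝ᵥ w = fderiv ℝ U q w := by
  conv_rhs => rw [pi_eq_sum_univ' w, map_sum]
  simp only [dotProduct, grad, map_smul, smul_eq_mul]
  refine Finset.sum_congr rfl fun i _ => ?_
  rw [mul_comm]

theorem hidden_eq_fderiv (M : Matrix (Fin m) (Fin m) ℝ) (g : (Fin m → ℝ) → (Fin ν → ℝ))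
    (q p : Fin m → ℝ) : hidden M g q p = fderiv ℝ g q (M⁻¹ *ᵥ p) :=
  gradMat_transpose_mulVec g q _

/-- The force `-∇U(q) - ∇g(q) l`. -/
def force (U : (Fin m → ℝ) → ℝ) (g : (Fin m → ℝ) → (Fin ν → ℝ)) (q : Fin m → ℝ)
    (l : Fin ν → ℝ) : Fin m → ℝ :=
  -grad U q - gradMat g q *ᵥ l

/-- The second time derivative of `g` along a motion with position `q`, momentum `p` and
multiplier `l`. -/
def accel (M : Matrix (Fin m) (Fin m) ℝ) (U : (Fin m → ℝ) → ℝ)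
    (g : (Fin m → ℝ) → (Fin ν → ℝ)) (q p : Fin m → ℝ) (l : Fin ν → ℝ) : Fin ν → ℝ :=
  hess g q (M⁻¹ *ᵥ p) (M⁻¹ *ᵥ p) + fderiv ℝ g q (M⁻¹ *ᵥ force U g q l)

theorem accel_eq (M : Matrix (Fin m) (Fin m) ℝ) (U : (Fin m → ℝ) → ℝ)
    (g : (Fin m → ℝ) → (Fin ν → ℝ)) (q p : Fin m → ℝ) (l : Fin ν → ℝ) :
    accel M U g q p l = hess g q (M⁻¹ *ᵥ p) (M⁻¹ *ᵥ p) -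
      (gradMat g q)ᵀ *ᵥ (M⁻¹ *ᵥ grad U q) - gramMat M g q *ᵥ l := by
  rw [accel, force, ← gradMat_transpose_mulVec, gramMat, Matrix.mulVec_sub, Matrix.mulVec_sub,
    Matrix.mulVec_neg, Matrix.mulVec_neg]
  simp only [Matrix.mulVec_mulVec, Matrix.mul_assoc]
  abel

theorem accel_sub_accel (M : Matrix (Fin m) (Fin m) ℝ) (U : (Fin m → ℝ) → ℝ)
    (g : (Fin m → ℝ) → (Fin ν → ℝ)) (q p : Fin m → ℝ) (l l' : Fin ν → ℝ) :
    accel M U g q p l - accel M U g q p l' = -(gramMat M g q *ᵥ (l - l')) := by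
  rw [accel_eq, accel_eq, Matrix.mulVec_sub]
  abel

/-- This is what singles out λ(q,p): the multiplier that annihilates the second derivative of the
constraint. -/
theorem accel_multiplier {M : Matrix (Fin m) (Fin m) ℝ} {U : (Fin m → ℝ) → ℝ}
    {g : (Fin m → ℝ) → (Fin ν → ℝ)} {q : Fin m → ℝ} (hreg : IsUnit (gramMat M g q))
    (p : Fin m → ℝ) : accel M U g q p (multiplier M U g q p) = 0 := by
  rw [accel_eq, multiplier, Matrix.mulVec_mulVec _ (gramMat M g q),
    Matrix.mul_nonsing_inv _ ((Matrix.isUnit_iff_isUnit_det _).1 hreg), Matrix.one_mulVec, sub_self]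

section Smooth

variable {M : Matrix (Fin m) (Fin m) ℝ} {U : (Fin m → ℝ) → ℝ} {g : (Fin m → ℝ) → (Fin ν → ℝ)}

theorem contDiff_grad (hU : ContDiff ℝ 2 U) : ContDiff ℝ 1 (grad U) := by
  have : ContDiff ℝ 1 (fderiv ℝ U) := hU.fderiv_right (by norm_num)
  exact contDiff_pi.2 fun i => this.clm_apply contDiff_const

theorem contDiff_gradMat_apply (hg : ContDiff ℝ 2 g) (i : Fin m) (j : Fin ν) :
    ContDiff ℝ 1 fun q => gradMat g q i j := by
  have : ContDiff ℝ 1 (fderiv ℝ g) := hg.fderiv_right (by norm_num)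
  have h : ContDiff ℝ 1 fun q => fderiv ℝ g q (Pi.single i 1) := this.clm_apply contDiff_const
  exact contDiff_pi.1 h j

theorem contDiff_mulVec {n k : ℕ} (A : Matrix (Fin n) (Fin k) ℝ) :
    ContDiff ℝ 1 fun x : Fin k → ℝ => A *ᵥ x :=
  (LinearMap.toContinuousLinearMap (Matrix.mulVecLin A)).contDiff

theorem contDiff_force (hU : ContDiff ℝ 2 U) (hg : ContDiff ℝ 2 g) :
    ContDiff ℝ 1 fun x : (Fin m → ℝ) × (Fin ν → ℝ) => force U g x.1 x.2 := by
  have hgr : ContDiff ℝ 1 fun x : (Fin m → ℝ) × (Fin ν → ℝ) => grad U x.1 :=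
    (contDiff_grad hU).comp contDiff_fst
  refine hgr.neg.sub (contDiff_pi.2 fun i => ?_)
  simp only [Matrix.mulVec, dotProduct]
  refine ContDiff.sum fun j _ => ?_
  have hl : ContDiff ℝ 1 fun x : (Fin m → ℝ) × (Fin ν → ℝ) => x.2 := contDiff_snd
  exact ((contDiff_gradMat_apply hg i j).comp contDiff_fst).mul (contDiff_pi.1 hl j)

/-- The vector field of the local problem, with the multiplier as a constant third component. -/
def field (M : Matrix (Fin m) (Fin m) ℝ) (U : (Fin m → ℝ) → ℝ) (g : (Fin m → ℝ) → (Fin ν → ℝ))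
    (x : (Fin m → ℝ) × (Fin m → ℝ) × (Fin ν → ℝ)) :
    (Fin m → ℝ) × (Fin m → ℝ) × (Fin ν → ℝ) :=
  (M⁻¹ *ᵥ x.2.1, force U g x.1 x.2.2, 0)

theorem contDiff_field (M : Matrix (Fin m) (Fin m) ℝ) (hU : ContDiff ℝ 2 U)
    (hg : ContDiff ℝ 2 g) : ContDiff ℝ 1 (field M U g) :=
  ((contDiff_mulVec _).comp (contDiff_fst.comp contDiff_snd)).prodMk
    (((contDiff_force hU hg).comp (contDiff_fst.prodMk (contDiff_snd.comp contDiff_snd))).prodMk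
      contDiff_const)

theorem contDiff_accel (M : Matrix (Fin m) (Fin m) ℝ) (hU : ContDiff ℝ 2 U)
    (hg : ContDiff ℝ 3 g) :
    ContDiff ℝ 1 fun x : (Fin m → ℝ) × (Fin m → ℝ) × (Fin ν → ℝ) =>
      accel M U g x.1 x.2.1 x.2.2 := by
  have h1 : ContDiff ℝ 2 (fderiv ℝ g) := hg.fderiv_right (by norm_num)
  have h2 : ContDiff ℝ 1 (fderiv ℝ (fderiv ℝ g)) := h1.fderiv_right (by norm_num)
  have hp : ContDiff ℝ 1 fun x : (Fin m → ℝ) × (Fin m → ℝ) × (Fin ν → ℝ) => M⁻¹ *ᵥ x.2.1 :=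
    (contDiff_mulVec _).comp (contDiff_fst.comp contDiff_snd)
  have hf : ContDiff ℝ 1 fun x : (Fin m → ℝ) × (Fin m → ℝ) × (Fin ν → ℝ) =>
      M⁻¹ *ᵥ force U g x.1 x.2.2 :=
    (contDiff_mulVec _).comp ((contDiff_force hU (hg.of_le (by norm_num))).comp
      (contDiff_fst.prodMk (contDiff_snd.comp contDiff_snd)))
  exact (((h2.comp contDiff_fst).clm_apply hp).clm_apply hp).add
    (((h1.of_le (by norm_num)).comp contDiff_fst).clm_apply hf)

theorem contDiff_gramMat_apply (M : Matrix (Fin m) (Fin m) ℝ) (hg : ContDiff ℝ 2 g)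
    (i j : Fin ν) : ContDiff ℝ 1 fun q => gramMat M g q i j := by
  simp only [gramMat, Matrix.mul_apply, Matrix.transpose_apply]
  exact ContDiff.sum fun k _ => (ContDiff.sum fun k' _ =>
    (contDiff_gradMat_apply hg _ _).mul contDiff_const).mul (contDiff_gradMat_apply hg _ _)

end Smooth

section Motion

variable {M : Matrix (Fin m) (Fin m) ℝ} {U : (Fin m → ℝ) → ℝ} {g : (Fin m → ℝ) → (Fin ν → ℝ)}
  {q₀ p₀ : Fin m → ℝ} {T : ℝ} {Λ : ℝ → (Fin ν → ℝ)} {x y : ℝ → (Fin m → ℝ)}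

theorem IsMotion.mono (H : IsMotion M U g q₀ p₀ T Λ x y) {h : ℝ} (hh : h ≤ T) :
    IsMotion M U g q₀ p₀ h Λ x y :=
  have hs : Icc 0 h ⊆ Icc 0 T := Icc_subset_Icc_right hh
  ⟨H.init_pos, H.init_mom, fun t ht => (H.deriv_pos t (hs ht)).mono hs,
    fun t ht => (H.deriv_mom t (hs ht)).mono hs⟩

theorem IsMotion.hasDerivWithinAt_constraint (H : IsMotion M U g q₀ p₀ T Λ x y)
    (hg : ContDiff ℝ 2 g) {t : ℝ} (ht : t ∈ Icc 0 T) :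
    HasDerivWithinAt (fun s => g (x s)) (hidden M g (x t) (y t)) (Icc 0 T) t := by
  rw [hidden_eq_fderiv]
  exact ((hg.differentiable (by norm_num) (x t)).hasFDerivAt).comp_hasDerivWithinAt t
    (H.deriv_pos t ht)

theorem hasDerivWithinAt_mulVec {n k : ℕ} (A : Matrix (Fin n) (Fin k) ℝ) {w : ℝ → Fin k → ℝ}
    {w' : Fin k → ℝ} {s : Set ℝ} {t : ℝ} (hw : HasDerivWithinAt w w' s t) :
    HasDerivWithinAt (fun r => A *ᵥ w r) (A *ᵥ w') s t :=
  (LinearMap.toContinuousLinearMap (Matrix.mulVecLin A)).hasFDerivAt.comp_hasDerivWithinAt t hw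

theorem IsMotion.hasDerivWithinAt_hidden (H : IsMotion M U g q₀ p₀ T Λ x y)
    (hg : ContDiff ℝ 2 g) {t : ℝ} (ht : t ∈ Icc 0 T) :
    HasDerivWithinAt (fun s => hidden M g (x s) (y s)) (accel M U g (x t) (y t) (Λ t))
      (Icc 0 T) t := by
  simp only [hidden_eq_fderiv]
  have h1 : ContDiff ℝ 1 (fderiv ℝ g) := hg.fderiv_right (by norm_num)
  have hD : HasDerivWithinAt (fun s => fderiv ℝ g (x s))
      (fderiv ℝ (fderiv ℝ g) (x t) (M⁻¹ *ᵥ y t)) (Icc 0 T) t :=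
    ((h1.differentiable (by norm_num) (x t)).hasFDerivAt).comp_hasDerivWithinAt t
      (H.deriv_pos t ht)
  exact hD.clm_apply (hasDerivWithinAt_mulVec _ (H.deriv_mom t ht))

theorem HasDerivWithinAt.dotProduct {n : ℕ} {v w : ℝ → Fin n → ℝ} {v' w' : Fin n → ℝ}
    {s : Set ℝ} {t : ℝ} (hv : HasDerivWithinAt v v' s t) (hw : HasDerivWithinAt w w' s t) :
    HasDerivWithinAt (fun r => v r ⬝ᵥ w r) (v' ⬝ᵥ w t + v t ⬝ᵥ w') s t := by
  simp only [_root_.dotProduct, ← Finset.sum_add_distrib]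
  exact HasDerivWithinAt.fun_sum fun i _ =>
    (hasDerivWithinAt_pi.1 hv i).mul (hasDerivWithinAt_pi.1 hw i)

/-- Along a motion with constant multiplier `l` the quantity `H + g ⬝ᵥ l` is conserved. -/
theorem IsMotion.hamiltonian_add_constraint {l : Fin ν → ℝ}
    (H : IsMotion M U g q₀ p₀ T (fun _ => l) x y) (hM : M.IsSymm)
    (hU : Differentiable ℝ U) (hg : ContDiff ℝ 2 g) (hT : 0 ≤ T) :
    hamiltonian M U (x T) (y T) + g (x T) ⬝ᵥ l = hamiltonian M U q₀ p₀ + g q₀ ⬝ᵥ l := by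
  have hMinv : (M⁻¹)ᵀ = M⁻¹ := by rw [Matrix.transpose_nonsing_inv, hM.eq]
  have hswap : ∀ a b : Fin m → ℝ, a ⬝ᵥ (M⁻¹ *ᵥ b) = b ⬝ᵥ (M⁻¹ *ᵥ a) := by
    intro a b
    rw [Matrix.dotProduct_mulVec, ← Matrix.mulVec_transpose, hMinv, dotProduct_comm]
  have key : ∀ t ∈ Icc 0 T, HasDerivWithinAt
      (fun s => hamiltonian M U (x s) (y s) + g (x s) ⬝ᵥ l) 0 (Icc 0 T) t := by
    intro t ht
    have hy := H.deriv_mom t ht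
    have h1 := (HasDerivWithinAt.dotProduct hy (hasDerivWithinAt_mulVec M⁻¹ hy)).const_mul
      (1 / 2 : ℝ)
    have h2 := (hU (x t)).hasFDerivAt.comp_hasDerivWithinAt t (H.deriv_pos t ht)
    have h3 := HasDerivWithinAt.dotProduct (H.hasDerivWithinAt_constraint hg ht)
      (hasDerivWithinAt_const t (Icc 0 T) l)
    refine ((h1.add h2).add h3).congr_deriv ?_
    -- The rate of change of g·l is the power of ∇g·l, which cancels the power of the constraint
    -- force in the rate of change of H.
    have e : (hidden M g (x t) (y t)) ⬝ᵥ l = (gradMat g (x t) *ᵥ l) ⬝ᵥ (M⁻¹ *ᵥ y t) := by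
      rw [hidden, Matrix.mulVec_transpose, ← Matrix.dotProduct_mulVec, dotProduct_comm]
    rw [hswap (y t), ← grad_dotProduct, dotProduct_zero, add_zero, e, sub_dotProduct,
      neg_dotProduct]
    ring
  have := norm_sub_le_of_hasDerivWithinAt (C := 0) key (by simp) hT
  rw [zero_mul, norm_le_zero_iff, sub_eq_zero] at this
  rw [this, H.init_pos, H.init_mom]

theorem IsMotion.hasDerivWithinAt_field {l : Fin ν → ℝ}
    (H : IsMotion M U g q₀ p₀ T (fun _ => l) x y) {t : ℝ} (ht : t ∈ Icc 0 T) :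
    HasDerivWithinAt (fun s => (x s, y s, l)) (field M U g (x t, y t, l)) (Icc 0 T) t :=
  (H.deriv_pos t ht).prodMk ((H.deriv_mom t ht).prodMk (hasDerivWithinAt_const _ _ _))

/-- Lets an arbitrary solution of the local problem be replaced by the member of a constructed
family with the same multiplier. -/
theorem IsMotion.eqOn {l : Fin ν → ℝ} {x' y' : ℝ → Fin m → ℝ}
    (H : IsMotion M U g q₀ p₀ T (fun _ => l) x y) (H' : IsMotion M U g q₀ p₀ T (fun _ => l) x' y')
    (hU : ContDiff ℝ 2 U) (hg : ContDiff ℝ 2 g) : EqOn x x' (Icc 0 T) ∧ EqOn y y' (Icc 0 T) := by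
  have := integralCurve_eqOn (contDiff_field M hU hg) (fun t ht => H.hasDerivWithinAt_field ht)
    (fun t ht => H'.hasDerivWithinAt_field ht)
    (by simp [H.init_pos, H.init_mom, H'.init_pos, H'.init_mom])
  exact ⟨fun t ht => congrArg Prod.fst (this ht),
    fun t ht => congrArg (fun z => z.2.1) (this ht)⟩

end Motion

end

/-! ### Uniform Taylor estimates for the local problem. -/

section

section Curves

theorem hasDerivWithinAt_id_smul {F : Type*} [NormedAddCommGroup F] [NormedSpace ℝ F]
    (a : F) (s : Set ℝ) (t : ℝ) : HasDerivWithinAt (fun t : ℝ => t • a) a s t := by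
  simpa using (hasDerivWithinAt_id t s).smul_const a

theorem hasDerivWithinAt_half_sq_smul {F : Type*} [NormedAddCommGroup F] [NormedSpace ℝ F]
    (a : F) (s : Set ℝ) (t : ℝ) :
    HasDerivWithinAt (fun t : ℝ => (t ^ 2 / 2) • a) (t • a) s t := by
  have := ((((hasDerivAt_id t).pow 2).div_const 2).smul_const a).hasDerivWithinAt (s := s)
  simpa using this

variable {E : Type*} [NormedAddCommGroup E] [NormedSpace ℝ E] {f : E → E} {s : Set E}
  {K : NNReal} {B T : ℝ} {γ δ : ℝ → E}

theorem integralCurve_norm_sub_init_le (hB : ∀ x ∈ s, ‖f x‖ ≤ B)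
    (hγ : ∀ t ∈ Icc (0 : ℝ) T, HasDerivWithinAt γ (f (γ t)) (Icc 0 T) t)
    (mγ : ∀ t, γ t ∈ s) {t : ℝ} (ht : t ∈ Icc (0 : ℝ) T) : ‖γ t - γ 0‖ ≤ B * t := by
  have hsub : Icc (0 : ℝ) t ⊆ Icc 0 T := Icc_subset_Icc_right ht.2
  exact norm_sub_le_of_hasDerivWithinAt (fun r hr => (hγ r (hsub hr)).mono hsub)
    (fun r _ => hB _ (mγ r)) ht.1

theorem integralCurve_norm_taylor_le (hK : LipschitzOnWith K f s) (hB : ∀ x ∈ s, ‖f x‖ ≤ B)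
    (hB0 : 0 ≤ B)
    (hγ : ∀ t ∈ Icc (0 : ℝ) T, HasDerivWithinAt γ (f (γ t)) (Icc 0 T) t)
    (mγ : ∀ t, γ t ∈ s) {t : ℝ} (ht : t ∈ Icc (0 : ℝ) T) :
    ‖γ t - γ 0 - t • f (γ 0)‖ ≤ K * B * t ^ 2 := by
  refine norm_le_pow_of_hasDerivWithinAt (w := fun t => γ t - γ 0 - t • f (γ 0))
    (w' := fun t => f (γ t) - f (γ 0)) 1 (by positivity) (fun r hr => ?_) (by simp)
    (fun r hr => ?_) ht
  · exact ((hγ r hr).sub_const (γ 0)).sub (hasDerivWithinAt_id_smul (f (γ 0)) _ r)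
  · calc ‖f (γ r) - f (γ 0)‖ ≤ K * ‖γ r - γ 0‖ := by
          simpa [dist_eq_norm] using hK.dist_le_mul _ (mγ r) _ (mγ 0)
      _ ≤ K * (B * r) := mul_le_mul_of_nonneg_left
          (integralCurve_norm_sub_init_le hB hγ mγ hr) K.2
      _ = K * B * r ^ 1 := by ring

/-- The difference of two integral curves varies slowly. -/
theorem integralCurve_norm_sub_sub_le (hK : LipschitzOnWith K f s)
    (hγ : ∀ t ∈ Icc (0 : ℝ) T, HasDerivWithinAt γ (f (γ t)) (Icc 0 T) t)
    (hδ : ∀ t ∈ Icc (0 : ℝ) T, HasDerivWithinAt δ (f (δ t)) (Icc 0 T) t)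
    (mγ : ∀ t, γ t ∈ s) (mδ : ∀ t, δ t ∈ s) {t : ℝ} (ht : t ∈ Icc (0 : ℝ) T) :
    ‖(γ t - δ t) - (γ 0 - δ 0)‖ ≤ K * Real.exp (K * T) * ‖γ 0 - δ 0‖ * t := by
  have hsub : Icc (0 : ℝ) t ⊆ Icc 0 T := Icc_subset_Icc_right ht.2
  refine norm_sub_le_of_hasDerivWithinAt (w := fun t => γ t - δ t)
    (w' := fun t => f (γ t) - f (δ t))
    (fun r hr => ((hγ r (hsub hr)).sub (hδ r (hsub hr))).mono hsub) (fun r hr => ?_) ht.1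
  calc ‖f (γ r) - f (δ r)‖ ≤ K * ‖γ r - δ r‖ := by
        simpa [dist_eq_norm] using hK.dist_le_mul _ (mγ r) _ (mδ r)
    _ ≤ K * (Real.exp (K * T) * ‖γ 0 - δ 0‖) := mul_le_mul_of_nonneg_left
        (integralCurve_norm_sub_le hK hγ hδ mγ mδ (hsub hr)) K.2
    _ = _ := by ring

end Curves

variable {m ν : ℕ} {M : Matrix (Fin m) (Fin m) ℝ} {U : (Fin m → ℝ) → ℝ}
  {g : (Fin m → ℝ) → (Fin ν → ℝ)} {q₀ p₀ : Fin m → ℝ}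

theorem exists_gramMat_mulVec_lipschitz (M : Matrix (Fin m) (Fin m) ℝ) (hg : ContDiff ℝ 2 g)
    (r : ℝ) : ∃ C, 0 ≤ C ∧ ∀ q ∈ Metric.closedBall (0 : Fin m → ℝ) r,
      ∀ q' ∈ Metric.closedBall (0 : Fin m → ℝ) r, ∀ k : Fin ν → ℝ,
        ‖gramMat M g q *ᵥ k - gramMat M g q' *ᵥ k‖ ≤ C * ‖q - q'‖ * ‖k‖ := by
  have hc : ContDiff ℝ 1 fun (q : Fin m → ℝ) (i j : Fin ν) => gramMat M g q i j :=
    contDiff_pi.2 fun i => contDiff_pi.2 fun j => contDiff_gramMat_apply M hg i j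
  obtain ⟨K, hK⟩ := exists_lipschitzOnWith_closedBall hc r
  refine ⟨ν * K, by positivity, fun q hq q' hq' k => ?_⟩
  have hK' := hK.dist_le_mul q hq q' hq'
  rw [dist_eq_norm, dist_eq_norm] at hK'
  refine (pi_norm_le_iff_of_nonneg (by positivity)).2 fun i => ?_
  rw [← Matrix.sub_mulVec]
  simp only [Matrix.mulVec, dotProduct, Matrix.sub_apply]
  calc ‖∑ j, (gramMat M g q i j - gramMat M g q' i j) * k j‖
      ≤ ∑ _j : Fin ν, K * ‖q - q'‖ * ‖k‖ := by
        refine norm_sum_le_of_le _ fun j _ => ?_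
        rw [norm_mul]
        refine mul_le_mul ?_ (norm_le_pi_norm k j) (norm_nonneg _) (by positivity)
        refine le_trans ?_ hK'
        exact (norm_le_pi_norm ((fun j => gramMat M g q i j) - fun j => gramMat M g q' i j) j).trans
          (norm_le_pi_norm ((fun i j => gramMat M g q i j) - fun i j => gramMat M g q' i j) i)
    _ = ν * K * ‖q - q'‖ * ‖k‖ := by
        rw [Finset.sum_const, Finset.card_univ, Fintype.card_fin, nsmul_eq_mul]
        ring

/-- Solutions of the local problem on `[0, ε]` for all multipliers of norm at most `R`, with
Taylor estimates that are uniform in the multiplier. -/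
structure IsLocalFlow (M : Matrix (Fin m) (Fin m) ℝ) (U : (Fin m → ℝ) → ℝ)
    (g : (Fin m → ℝ) → (Fin ν → ℝ)) (q₀ p₀ : Fin m → ℝ) (R ε C : ℝ)
    (u v : (Fin ν → ℝ) → ℝ → (Fin m → ℝ)) : Prop where
  motion : ∀ l, ‖l‖ ≤ R → IsMotion M U g q₀ p₀ ε (fun _ => l) (u l) (v l)
  pos_le : ∀ l, ‖l‖ ≤ R → ∀ t ∈ Icc (0 : ℝ) ε, ‖u l t - q₀ - t • (M⁻¹ *ᵥ p₀)‖ ≤ C * t ^ 2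
  mom_le : ∀ l, ‖l‖ ≤ R → ∀ t ∈ Icc (0 : ℝ) ε, ‖v l t - p₀ - t • force U g q₀ l‖ ≤ C * t ^ 2
  hidden_le : ∀ l, ‖l‖ ≤ R → ∀ t ∈ Icc (0 : ℝ) ε,
    ‖hidden M g (u l t) (v l t) - t • accel M U g q₀ p₀ l‖ ≤ C * t ^ 2
  constraint_le : ∀ l, ‖l‖ ≤ R → ∀ t ∈ Icc (0 : ℝ) ε,
    ‖g (u l t) - (t ^ 2 / 2) • accel M U g q₀ p₀ l‖ ≤ C * t ^ 3
  constraint_sub_le : ∀ l l', ‖l‖ ≤ R → ‖l'‖ ≤ R → ∀ t ∈ Icc (0 : ℝ) ε,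
    ‖g (u l t) - g (u l' t) + (t ^ 2 / 2) • (gramMat M g q₀ *ᵥ (l - l'))‖ ≤
      C * ‖l - l'‖ * t ^ 3

/-- All estimates come from bounding the highest derivative and applying the mean value inequality
repeatedly. For `constraint_sub_le` the starting point is the difference of two accelerations, which
equals -gramMat(q₀)(l - l') up to O(t‖l - l'‖). -/
theorem exists_isLocalFlow (M : Matrix (Fin m) (Fin m) ℝ) (hU : ContDiff ℝ 2 U)
    (hg : ContDiff ℝ 3 g) (hq₀ : g q₀ = 0) (hp₀ : hidden M g q₀ p₀ = 0) {R : ℝ} (hR : 0 ≤ R) :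
    ∃ ε > 0, ∃ C > 0, ∃ u v, IsLocalFlow M U g q₀ p₀ R ε C u v := by
  have hg2 : ContDiff ℝ 2 g := hg.of_le (by norm_num)
  have hf := contDiff_field M hU hg2
  set r : ℝ := ‖q₀‖ + ‖p₀‖ + R with hr
  have hr0 : 0 ≤ r := by positivity
  obtain ⟨ε, hε, hex⟩ := exists_uniform_integralCurve hf hr0
  obtain ⟨K, hK⟩ := exists_lipschitzOnWith_closedBall hf (r + 1)
  obtain ⟨A, hA⟩ := exists_lipschitzOnWith_closedBall (contDiff_accel M hU hg) (r + 1)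
  obtain ⟨G, hG0, hG⟩ := exists_gramMat_mulVec_lipschitz M hg2 (r + 1)
  obtain ⟨B, hB⟩ := (isCompact_closedBall (0 : (Fin m → ℝ) × (Fin m → ℝ) × (Fin ν → ℝ))
    (r + 1)).exists_bound_of_continuousOn hf.continuous.continuousOn
  have hB0 : 0 ≤ B := (norm_nonneg _).trans (hB 0 (by simpa using by linarith))
  have hx : ∀ l : Fin ν → ℝ, ‖l‖ ≤ R → (q₀, p₀, l) ∈
      Metric.closedBall (0 : (Fin m → ℝ) × (Fin m → ℝ) × (Fin ν → ℝ)) r := by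
    intro l hl
    have := norm_nonneg q₀
    have := norm_nonneg p₀
    simp only [mem_closedBall_zero_iff, Prod.norm_def, max_le_iff]
    refine ⟨?_, ?_, ?_⟩ <;> linarith
  have hex' : ∀ l : Fin ν → ℝ, ∃ γ : ℝ → (Fin m → ℝ) × (Fin m → ℝ) × (Fin ν → ℝ), ‖l‖ ≤ R →
      γ 0 = (q₀, p₀, l) ∧ (∀ t, γ t ∈ Metric.closedBall 0 (r + 1)) ∧
      ∀ t ∈ Icc (0 : ℝ) ε, HasDerivWithinAt γ (field M U g (γ t)) (Icc 0 ε) t := by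
    intro l
    by_cases hl : ‖l‖ ≤ R
    · obtain ⟨γ, hγ⟩ := hex _ (hx l hl)
      exact ⟨γ, fun _ => hγ⟩
    · exact ⟨0, fun h => absurd h hl⟩
  choose γ hγ using hex'
  -- The third component of `field` is zero, so the multiplier stays at its initial value.
  have hl3 : ∀ l, ‖l‖ ≤ R → ∀ t ∈ Icc (0 : ℝ) ε, (γ l t).2.2 = l := by
    intro l hl t ht
    have := norm_le_pow_of_hasDerivWithinAt (w := fun t => (γ l t).2.2 - l) (w' := fun _ => 0)
      (C := 0) 0 le_rfl (fun s hs => ?_) (by simp [(hγ l hl).1]) (by simp) ht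
    · simpa [sub_eq_zero] using this
    · exact (((hγ l hl).2.2 s hs).snd.snd).sub_const l
  have hmot : ∀ l, ‖l‖ ≤ R →
      IsMotion M U g q₀ p₀ ε (fun _ => l) (fun t => (γ l t).1) (fun t => (γ l t).2.1) := by
    intro l hl
    refine ⟨by simp [(hγ l hl).1], by simp [(hγ l hl).1], fun t ht => ?_, fun t ht => ?_⟩
    · exact ((hγ l hl).2.2 t ht).fst
    · have := ((ContinuousLinearMap.fst ℝ (Fin m → ℝ) (Fin ν → ℝ)).comp
        (ContinuousLinearMap.snd ℝ (Fin m → ℝ) ((Fin m → ℝ) × (Fin ν → ℝ)))).hasFDerivAt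
        |>.comp_hasDerivWithinAt t ((hγ l hl).2.2 t ht)
      refine this.congr_deriv ?_
      simp [field, force, hl3 l hl t ht]
  have hacc : ∀ l, ‖l‖ ≤ R → ∀ t ∈ Icc (0 : ℝ) ε,
      ‖accel M U g (γ l t).1 (γ l t).2.1 l - accel M U g q₀ p₀ l‖ ≤ A * B * t ^ 1 := by
    intro l hl t ht
    have h1 := hA.dist_le_mul _ ((hγ l hl).2.1 t) _ ((hγ l hl).2.1 0)
    rw [dist_eq_norm, dist_eq_norm, hl3 l hl t ht, (hγ l hl).1] at h1
    have h2 := integralCurve_norm_sub_init_le hB (hγ l hl).2.2 (hγ l hl).2.1 ht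
    rw [(hγ l hl).1] at h2
    calc _ ≤ _ := h1
      _ ≤ A * (B * t) := mul_le_mul_of_nonneg_left h2 A.2
      _ = _ := by ring
  have hhid : ∀ l, ‖l‖ ≤ R → ∀ t ∈ Icc (0 : ℝ) ε,
      ‖hidden M g (γ l t).1 (γ l t).2.1 - t • accel M U g q₀ p₀ l‖ ≤ A * B * t ^ 2 := by
    intro l hl t ht
    refine norm_le_pow_of_hasDerivWithinAt
      (w := fun t => hidden M g (γ l t).1 (γ l t).2.1 - t • accel M U g q₀ p₀ l) 1
      (by positivity) (fun s hs => ?_) (by simp [(hγ l hl).1, hp₀]) (hacc l hl) ht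
    exact ((hmot l hl).hasDerivWithinAt_hidden hg2 hs).sub (hasDerivWithinAt_id_smul _ _ s)
  set C₁ : ℝ := A * (K * Real.exp (K * ε)) + G * B with hC₁
  have hsub : ∀ l l', ‖l‖ ≤ R → ‖l'‖ ≤ R → ∀ t ∈ Icc (0 : ℝ) ε,
      ‖accel M U g (γ l t).1 (γ l t).2.1 l - accel M U g (γ l' t).1 (γ l' t).2.1 l' +
        gramMat M g q₀ *ᵥ (l - l')‖ ≤ C₁ * ‖l - l'‖ * t ^ 1 := by
    intro l l' hl hl' t ht
    -- The intermediate state takes position and momentum from the curve of l' but the multiplier l.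
    -- It splits the difference of accelerations into a change of state at fixed l and a change of
    -- multiplier at a fixed state, the latter being exactly linear.
    have hmem : ((γ l' t).1, (γ l' t).2.1, l) ∈
        Metric.closedBall (0 : (Fin m → ℝ) × (Fin m → ℝ) × (Fin ν → ℝ)) (r + 1) := by
      have h1 := (hγ l hl).2.1 t
      have h2 := (hγ l' hl').2.1 t
      simp only [mem_closedBall_zero_iff, Prod.norm_def, max_le_iff] at h1 h2 ⊢
      rw [hl3 l hl t ht] at h1
      exact ⟨h2.1, h2.2.1, h1.2.2⟩
    have h1 := hA.dist_le_mul _ ((hγ l hl).2.1 t) _ hmem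
    rw [dist_eq_norm, dist_eq_norm, hl3 l hl t ht] at h1
    have h2 := integralCurve_norm_sub_sub_le hK (hγ l hl).2.2 (hγ l' hl').2.2 (hγ l hl).2.1
      (hγ l' hl').2.1 ht
    rw [(hγ l hl).1, (hγ l' hl').1] at h2
    have h3 : ‖(q₀, p₀, l) - (q₀, p₀, l')‖ = ‖l - l'‖ := by
      simp [Prod.norm_def]
    -- Removing the multiplier component amounts to subtracting the initial difference, so `h2`
    -- supplies the needed extra factor t.
    have h4 : γ l t - ((γ l' t).1, (γ l' t).2.1, l) =
        γ l t - γ l' t - ((q₀, p₀, l) - (q₀, p₀, l')) := by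
      ext : 2
      · simp
      · simp
      · simp [hl3 l hl t ht, hl3 l' hl' t ht]
    rw [h4] at h1
    rw [h3] at h2
    have h5 : ‖(γ l' t).1 - q₀‖ ≤ B * t := by
      have := integralCurve_norm_sub_init_le hB (hγ l' hl').2.2 (hγ l' hl').2.1 ht
      rw [(hγ l' hl').1] at this
      exact (norm_fst_le _).trans this
    have h6 := hG q₀ (by
        have := hx l hl
        simp only [mem_closedBall_zero_iff, Prod.norm_def, max_le_iff] at this ⊢
        linarith [this.1]) (γ l' t).1 (by
        have := (hγ l' hl').2.1 t
        simp only [mem_closedBall_zero_iff, Prod.norm_def, max_le_iff] at this ⊢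
        exact this.1) (l - l')
    rw [norm_sub_rev] at h5
    have h7 := accel_sub_accel M U g (γ l' t).1 (γ l' t).2.1 l l'
    have h8 : accel M U g (γ l t).1 (γ l t).2.1 l - accel M U g (γ l' t).1 (γ l' t).2.1 l' +
        gramMat M g q₀ *ᵥ (l - l') =
        (accel M U g (γ l t).1 (γ l t).2.1 l - accel M U g (γ l' t).1 (γ l' t).2.1 l) +
        (gramMat M g q₀ *ᵥ (l - l') - gramMat M g (γ l' t).1 *ᵥ (l - l')) := by
      rw [sub_eq_add_neg (gramMat M g q₀ *ᵥ (l - l')), ← h7]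
      abel
    rw [h8]
    calc _ ≤ A * (K * Real.exp (K * ε) * ‖l - l'‖ * t) + G * (B * t) * ‖l - l'‖ := by
          refine (norm_add_le _ _).trans (add_le_add ?_ ?_)
          · exact h1.trans (mul_le_mul_of_nonneg_left h2 A.2)
          · refine h6.trans ?_
            gcongr
      _ = _ := by rw [hC₁]; ring
  have hC₁0 : 0 ≤ C₁ := by positivity
  set C : ℝ := K * B + A * B + C₁ + 1 with hC
  have hKB : 0 ≤ K * B := by positivity
  have hAB : 0 ≤ A * B := by positivity
  have htay : ∀ l, ‖l‖ ≤ R → ∀ t ∈ Icc (0 : ℝ) ε,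
      ‖γ l t - (q₀, p₀, l) - t • field M U g (q₀, p₀, l)‖ ≤ C * t ^ 2 := by
    intro l hl t ht
    have := integralCurve_norm_taylor_le hK hB hB0 (hγ l hl).2.2 (hγ l hl).2.1 ht
    rw [(hγ l hl).1] at this
    exact this.trans (mul_le_mul_of_nonneg_right (by linarith) (by positivity))
  refine ⟨ε, hε, C, by linarith, fun l t => (γ l t).1, fun l t => (γ l t).2.1, hmot, ?_, ?_, ?_,
    ?_, ?_⟩
  · exact fun l hl t ht => (norm_fst_le _).trans (htay l hl t ht)
  · exact fun l hl t ht =>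
      (norm_fst_le _).trans ((norm_snd_le _).trans (htay l hl t ht))
  · exact fun l hl t ht => (hhid l hl t ht).trans
      (mul_le_mul_of_nonneg_right (by linarith) (by positivity))
  · intro l hl t ht
    have := norm_le_pow_of_hasDerivWithinAt
      (w := fun t => g (γ l t).1 - (t ^ 2 / 2) • accel M U g q₀ p₀ l) 2
      hAB (fun s hs => ((hmot l hl).hasDerivWithinAt_constraint hg2 hs).sub
        (hasDerivWithinAt_half_sq_smul _ _ _)) (by simp [(hγ l hl).1, hq₀]) (hhid l hl) ht
    have ht0 := ht.1
    exact this.trans (mul_le_mul_of_nonneg_right (by linarith) (by positivity))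
  · intro l l' hl hl' t ht
    have h1 : ∀ s ∈ Icc (0 : ℝ) ε, ‖hidden M g (γ l s).1 (γ l s).2.1 -
        hidden M g (γ l' s).1 (γ l' s).2.1 + s • (gramMat M g q₀ *ᵥ (l - l'))‖ ≤
        C₁ * ‖l - l'‖ * s ^ 2 := by
      intro s hs
      refine norm_le_pow_of_hasDerivWithinAt
        (w := fun s => hidden M g (γ l s).1 (γ l s).2.1 -
        hidden M g (γ l' s).1 (γ l' s).2.1 + s • (gramMat M g q₀ *ᵥ (l - l'))) 1
        (by positivity) (fun s hs => ?_) (by simp [(hγ l hl).1, (hγ l' hl').1])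
        (hsub l l' hl hl') hs
      exact (((hmot l hl).hasDerivWithinAt_hidden hg2 hs).sub
        ((hmot l' hl').hasDerivWithinAt_hidden hg2 hs)).add (hasDerivWithinAt_id_smul _ _ s)
    have := norm_le_pow_of_hasDerivWithinAt
      (w := fun t => g (γ l t).1 - g (γ l' t).1 + (t ^ 2 / 2) • (gramMat M g q₀ *ᵥ (l - l'))) 2
      (by positivity) (fun s hs => (((hmot l hl).hasDerivWithinAt_constraint hg2 hs).sub
        ((hmot l' hl').hasDerivWithinAt_constraint hg2 hs)).add
        (hasDerivWithinAt_half_sq_smul _ _ _)) (by simp [(hγ l hl).1, (hγ l' hl').1]) h1 ht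
    have ht0 := ht.1
    refine this.trans (mul_le_mul_of_nonneg_right (mul_le_mul_of_nonneg_right ?_ (norm_nonneg _))
      (by positivity))
    linarith

end

/-! ### The simplified Newton iteration for the multiplier. -/

section

variable {m ν : ℕ} {M : Matrix (Fin m) (Fin m) ℝ} {U : (Fin m → ℝ) → ℝ}
  {g : (Fin m → ℝ) → (Fin ν → ℝ)} {q₀ p₀ : Fin m → ℝ}

theorem exists_norm_mulVec_le {n k : ℕ} (A : Matrix (Fin n) (Fin k) ℝ) :
    ∃ β > 0, ∀ x, ‖A *ᵥ x‖ ≤ β * ‖x‖ := by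
  set L := LinearMap.toContinuousLinearMap (Matrix.mulVecLin A)
  refine ⟨‖L‖ + 1, by positivity, fun x => (L.le_opNorm x).trans ?_⟩
  gcongr
  linarith

/-- The simplified Newton map whose fixed points are the multipliers with `g (u l h) = 0`. -/
def newtonMap (M : Matrix (Fin m) (Fin m) ℝ) (g : (Fin m → ℝ) → (Fin ν → ℝ)) (q₀ : Fin m → ℝ)
    (u : (Fin ν → ℝ) → ℝ → (Fin m → ℝ)) (h : ℝ) (l : Fin ν → ℝ) : Fin ν → ℝ :=
  l + (2 / h ^ 2) • ((gramMat M g q₀)⁻¹ *ᵥ g (u l h))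

theorem gramMat_inv_mulVec (hreg : IsUnit (gramMat M g q₀)) (k : Fin ν → ℝ) :
    (gramMat M g q₀)⁻¹ *ᵥ (gramMat M g q₀ *ᵥ k) = k := by
  rw [Matrix.mulVec_mulVec, Matrix.nonsing_inv_mul _ ((Matrix.isUnit_iff_isUnit_det _).1 hreg),
    Matrix.one_mulVec]

section Newton

variable {u v : (Fin ν → ℝ) → ℝ → (Fin m → ℝ)} {R ε C β h : ℝ}

theorem newtonMap_eq_self_iff (hreg : IsUnit (gramMat M g q₀)) (hh : 0 < h) (l : Fin ν → ℝ) :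
    newtonMap M g q₀ u h l = l ↔ g (u l h) = 0 := by
  have h2 : (2 / h ^ 2 : ℝ) ≠ 0 := by positivity
  rw [newtonMap, add_eq_left, smul_eq_zero, or_iff_right h2]
  refine ⟨fun H => ?_, fun H => by rw [H, Matrix.mulVec_zero]⟩
  have := congrArg (gramMat M g q₀ *ᵥ ·) H
  simpa [Matrix.mulVec_mulVec,
    Matrix.mul_nonsing_inv _ ((Matrix.isUnit_iff_isUnit_det _).1 hreg)] using this

/-- The inverse Gram matrix cancels the linear part l - l' exactly. What remains is the O(h³) error
of `constraint_sub_le`, divided by h²/2. -/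
theorem IsLocalFlow.newtonMap_sub_le (H : IsLocalFlow M U g q₀ p₀ R ε C u v)
    (hreg : IsUnit (gramMat M g q₀)) (hβ : ∀ x, ‖(gramMat M g q₀)⁻¹ *ᵥ x‖ ≤ β * ‖x‖)
    (hβ0 : 0 ≤ β) (hh : 0 < h) (hhε : h ≤ ε) {l l' : Fin ν → ℝ} (hl : ‖l‖ ≤ R) (hl' : ‖l'‖ ≤ R) :
    ‖newtonMap M g q₀ u h l - newtonMap M g q₀ u h l'‖ ≤ 2 * β * C * h * ‖l - l'‖ := by
  have e : newtonMap M g q₀ u h l - newtonMap M g q₀ u h l' = (2 / h ^ 2) •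
      ((gramMat M g q₀)⁻¹ *ᵥ (g (u l h) - g (u l' h) +
        (h ^ 2 / 2) • (gramMat M g q₀ *ᵥ (l - l')))) := by
    rw [Matrix.mulVec_add, Matrix.mulVec_smul, gramMat_inv_mulVec hreg, smul_add, smul_smul,
      Matrix.mulVec_sub, smul_sub, newtonMap, newtonMap]
    have : (2 / h ^ 2 * (h ^ 2 / 2) : ℝ) = 1 := by field_simp
    rw [this, one_smul]
    abel
  have h1 := H.constraint_sub_le l l' hl hl' h ⟨hh.le, hhε⟩
  rw [e, norm_smul, Real.norm_of_nonneg (by positivity)]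
  calc _ ≤ 2 / h ^ 2 * (β * (C * ‖l - l'‖ * h ^ 3)) :=
        mul_le_mul_of_nonneg_left ((hβ _).trans (mul_le_mul_of_nonneg_left h1 hβ0)) (by positivity)
    _ = _ := by field_simp

theorem IsLocalFlow.newtonMap_multiplier_sub_le (H : IsLocalFlow M U g q₀ p₀ R ε C u v)
    (hreg : IsUnit (gramMat M g q₀)) (hβ : ∀ x, ‖(gramMat M g q₀)⁻¹ *ᵥ x‖ ≤ β * ‖x‖)
    (hβ0 : 0 ≤ β) (hh : 0 < h) (hhε : h ≤ ε) (hR : ‖multiplier M U g q₀ p₀‖ ≤ R) :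
    ‖newtonMap M g q₀ u h (multiplier M U g q₀ p₀) - multiplier M U g q₀ p₀‖ ≤
      2 * β * C * h := by
  have h1 := H.constraint_le _ hR h ⟨hh.le, hhε⟩
  rw [accel_multiplier hreg, smul_zero, sub_zero] at h1
  rw [newtonMap, add_sub_cancel_left, norm_smul, Real.norm_of_nonneg (by positivity)]
  calc _ ≤ 2 / h ^ 2 * (β * (C * h ^ 3)) :=
        mul_le_mul_of_nonneg_left ((hβ _).trans (mul_le_mul_of_nonneg_left h1 hβ0)) (by positivity)
    _ = _ := by field_simp

theorem IsLocalFlow.multiplier_unique (H : IsLocalFlow M U g q₀ p₀ R ε C u v)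
    (hreg : IsUnit (gramMat M g q₀)) (hβ : ∀ x, ‖(gramMat M g q₀)⁻¹ *ᵥ x‖ ≤ β * ‖x‖)
    (hβ0 : 0 ≤ β) (hh : 0 < h) (hhε : h ≤ ε) (hs : 2 * β * C * h ≤ 1 / 2) {l l' : Fin ν → ℝ}
    (hl : ‖l‖ ≤ R) (hl' : ‖l'‖ ≤ R) (hz : g (u l h) = 0) (hz' : g (u l' h) = 0) : l = l' := by
  have h1 := H.newtonMap_sub_le hreg hβ hβ0 hh hhε hl hl'
  rw [(newtonMap_eq_self_iff hreg hh l).2 hz, (newtonMap_eq_self_iff hreg hh l').2 hz'] at h1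
  have h2 := mul_le_mul_of_nonneg_right hs (norm_nonneg (l - l'))
  have h3 : ‖l - l'‖ ≤ 0 := by linarith
  exact sub_eq_zero.1 (norm_le_zero_iff.1 h3)

theorem IsLocalFlow.exists_multiplier
    (H : IsLocalFlow M U g q₀ p₀ (‖multiplier M U g q₀ p₀‖ + 1) ε C u v)
    (hreg : IsUnit (gramMat M g q₀)) (hβ : ∀ x, ‖(gramMat M g q₀)⁻¹ *ᵥ x‖ ≤ β * ‖x‖)
    (hβ0 : 0 ≤ β) (hh : 0 < h) (hhε : h ≤ ε) (hs : 2 * β * C * h ≤ 1 / 2) :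
    ∃ l, ‖l‖ ≤ ‖multiplier M U g q₀ p₀‖ + 1 ∧ g (u l h) = 0 ∧
      ‖l - multiplier M U g q₀ p₀‖ ≤ 4 * β * C * h := by
  set lam := multiplier M U g q₀ p₀ with hlam
  have hball : ∀ l ∈ Metric.closedBall lam 1, ‖l‖ ≤ ‖lam‖ + 1 := by
    intro l hl
    rw [mem_closedBall_iff_norm] at hl
    calc ‖l‖ = ‖lam + (l - lam)‖ := by rw [add_sub_cancel]
      _ ≤ _ := (norm_add_le _ _).trans (by linarith)
  have hlam1 : ‖lam‖ ≤ ‖lam‖ + 1 := by linarith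
  have h0 := H.newtonMap_multiplier_sub_le hreg hβ hβ0 hh hhε hlam1
  rw [← hlam] at h0
  have hcon : ∀ l ∈ Metric.closedBall lam 1, ∀ l' ∈ Metric.closedBall lam 1,
      ‖newtonMap M g q₀ u h l - newtonMap M g q₀ u h l'‖ ≤ 1 / 2 * ‖l - l'‖ := fun l hl l' hl' =>
    (H.newtonMap_sub_le hreg hβ hβ0 hh hhε (hball l hl) (hball l' hl')).trans
      (mul_le_mul_of_nonneg_right hs (norm_nonneg _))
  have hself : lam ∈ Metric.closedBall lam 1 := Metric.mem_closedBall_self zero_le_one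
  have hdist : ∀ l ∈ Metric.closedBall lam 1,
      ‖newtonMap M g q₀ u h l - lam‖ ≤ 1 / 2 * ‖l - lam‖ + 2 * β * C * h := by
    intro l hl
    calc _ = ‖(newtonMap M g q₀ u h l - newtonMap M g q₀ u h lam) +
          (newtonMap M g q₀ u h lam - lam)‖ := by rw [sub_add_sub_cancel]
      _ ≤ _ := (norm_add_le _ _).trans (add_le_add (hcon l hl lam hself) h0)
  -- The radius 1 is split evenly: at most 1/2 from contraction and at most 1/2 from the
  -- displacement of the centre.
  have hmaps : MapsTo (newtonMap M g q₀ u h) (Metric.closedBall lam 1)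
      (Metric.closedBall lam 1) := by
    intro l hl
    have := hdist l hl
    rw [mem_closedBall_iff_norm] at hl ⊢
    linarith
  have hcw : ContractingWith (1 / 2 : NNReal) (hmaps.restrict _ _ _) := by
    refine ⟨by norm_num, LipschitzWith.of_dist_le_mul fun x y => ?_⟩
    simpa [Subtype.dist_eq, dist_eq_norm] using hcon x x.2 y y.2
  obtain ⟨l, hl, hfix, -⟩ := hcw.exists_fixedPoint' Metric.isClosed_closedBall.isComplete hmaps
    hself (edist_ne_top _ _)
  refine ⟨l, hball l hl, (newtonMap_eq_self_iff hreg hh l).1 hfix, ?_⟩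
  have := hdist l hl
  rw [hfix.eq] at this
  linarith

end Newton

/-! ### Expansion of the constrained solution. -/

section Constrained

theorem isBigO_sq_of_hasDerivWithinAt {F : Type*} [NormedAddCommGroup F] [NormedSpace ℝ F]
    {w w' : ℝ → F} {T : ℝ} (hT : 0 < T)
    (hw : ∀ s ∈ Icc (0 : ℝ) T, HasDerivWithinAt w (w' s) (Icc 0 T) s) (h0 : w 0 = 0)
    (hO : w' =O[𝓝[Icc 0 T] 0] fun t : ℝ => t) : w =O[𝓝[>] 0] fun t : ℝ => t ^ 2 := by
  obtain ⟨c, hc, hb⟩ := hO.exists_pos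
  rw [IsBigOWith, nhdsWithin_Icc_eq_nhdsGE hT, Filter.Eventually,
    mem_nhdsGE_iff_exists_Icc_subset] at hb
  obtain ⟨δ, hδ, hb⟩ := hb
  have hδ' : 0 < min δ T := lt_min hδ hT
  have hsub : Icc 0 (min δ T) ⊆ Icc 0 T := Icc_subset_Icc_right (min_le_right _ _)
  refine IsBigO.of_bound c ?_
  filter_upwards [Ioc_mem_nhdsGT hδ'] with t ht
  have := norm_le_pow_of_hasDerivWithinAt 1 hc.le (fun s hs => (hw s (hsub hs)).mono hsub) h0
    (fun s hs => by
      have := hb ⟨hs.1, hs.2.trans (min_le_left _ _)⟩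
      rw [mem_ofPred_eq, Real.norm_of_nonneg hs.1] at this
      rwa [pow_one]) (Ioc_subset_Icc_self ht)
  rwa [Real.norm_of_nonneg (by positivity)]

variable {T : ℝ} {Λ : ℝ → (Fin ν → ℝ)} {q p : ℝ → (Fin m → ℝ)}

theorem hasDerivWithinAt_eq_zero_of_vanishing {F : Type*} [NormedAddCommGroup F]
    [NormedSpace ℝ F] {w : ℝ → F} {w' : F} {t : ℝ} (hT : 0 < T) (ht : t ∈ Icc 0 T)
    (hw : HasDerivWithinAt w w' (Icc 0 T) t) (h0 : ∀ s ∈ Icc 0 T, w s = 0) : w' = 0 :=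
  (uniqueDiffOn_Icc hT t ht).eq_deriv _ hw
    ((hasDerivWithinAt_const t (Icc 0 T) 0).congr h0 (h0 t ht))

theorem IsConstrainedMotion.hidden_eq_zero (H : IsConstrainedMotion M U g q₀ p₀ T Λ q p)
    (hg : ContDiff ℝ 2 g) (hT : 0 < T) {t : ℝ} (ht : t ∈ Icc 0 T) :
    hidden M g (q t) (p t) = 0 :=
  hasDerivWithinAt_eq_zero_of_vanishing hT ht (H.motion.hasDerivWithinAt_constraint hg ht)
    H.constraint

theorem IsConstrainedMotion.accel_eq_zero (H : IsConstrainedMotion M U g q₀ p₀ T Λ q p)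
    (hg : ContDiff ℝ 2 g) (hT : 0 < T) {t : ℝ} (ht : t ∈ Icc 0 T) :
    accel M U g (q t) (p t) (Λ t) = 0 :=
  hasDerivWithinAt_eq_zero_of_vanishing hT ht (H.motion.hasDerivWithinAt_hidden hg ht)
    fun _ hs => H.hidden_eq_zero hg hT hs

theorem IsMotion.isBigO_sub (H : IsMotion M U g q₀ p₀ T Λ q p) (hT : 0 < T) :
    ((fun t => q t - q₀) =O[𝓝[Icc 0 T] 0] fun t : ℝ => t) ∧
      (fun t => p t - p₀) =O[𝓝[Icc 0 T] 0] fun t : ℝ => t := by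
  have h0 : (0 : ℝ) ∈ Icc 0 T := ⟨le_rfl, hT.le⟩
  have h1 := (H.deriv_pos 0 h0).hasFDerivWithinAt.isBigO_sub
  have h2 := (H.deriv_mom 0 h0).hasFDerivWithinAt.isBigO_sub
  simp only [sub_zero] at h1 h2
  rw [H.init_pos] at h1
  rw [H.init_mom] at h2
  exact ⟨h1, h2⟩

theorem isBigO_comp_sub {E F : Type*} [NormedAddCommGroup E] [NormedSpace ℝ E]
    [NormedAddCommGroup F] [NormedSpace ℝ F] {f : E → F} (hf : ContDiff ℝ 1 f) {z : ℝ → E}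
    {z₀ : E} {s : Set ℝ} (hz : (fun t => z t - z₀) =O[𝓝[s] 0] fun t : ℝ => t) :
    (fun t => f (z t) - f z₀) =O[𝓝[s] 0] fun t : ℝ => t := by
  have ht : Tendsto (fun t : ℝ => t) (𝓝[s] 0) (𝓝 0) := tendsto_id.mono_left nhdsWithin_le_nhds
  have hlim : Tendsto z (𝓝[s] 0) (𝓝 z₀) := by
    have := hz.trans_tendsto ht
    simpa using this.add_const z₀
  exact ((hf.differentiable (by norm_num) z₀).isBigO_sub.comp_tendsto hlim).trans hz

/-- Since accel(q,p,Λ) = 0, gramMat(q)(Λ - λ₀) equals accel(q,p,λ₀), with λ₀ = λ(q₀,p₀); this is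
O(t) because it vanishes at t = 0 and `accel` is C¹. -/
theorem IsConstrainedMotion.multiplier_isBigO (H : IsConstrainedMotion M U g q₀ p₀ T Λ q p)
    (hU : ContDiff ℝ 2 U) (hg : ContDiff ℝ 3 g) (hreg : IsUnit (gramMat M g q₀)) (hT : 0 < T) :
    (fun t => Λ t - multiplier M U g q₀ p₀) =O[𝓝[Icc 0 T] 0] fun t : ℝ => t := by
  have hg2 : ContDiff ℝ 2 g := hg.of_le (by norm_num)
  obtain ⟨hq, hp⟩ := H.motion.isBigO_sub hT
  set lam := multiplier M U g q₀ p₀ with hlam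
  have hz : (fun t => ((q t, p t, lam) : (Fin m → ℝ) × (Fin m → ℝ) × (Fin ν → ℝ)) -
      (q₀, p₀, lam)) =O[𝓝[Icc 0 T] 0] fun t : ℝ => t := by
    have : (fun _ : ℝ => lam - lam) =O[𝓝[Icc 0 T] 0] fun t : ℝ => t := by
      simpa using isBigO_zero (E' := Fin ν → ℝ) (fun t : ℝ => t) (𝓝[Icc 0 T] 0)
    exact hq.prod_left (hp.prod_left this)
  have ha := isBigO_comp_sub (contDiff_accel M hU hg) hz
  simp only [hlam, accel_multiplier hreg, sub_zero] at ha
  rw [← hlam] at ha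
  obtain ⟨β, hβ0, hβ⟩ := exists_norm_mulVec_le (gramMat M g q₀)⁻¹
  obtain ⟨K, hK0, hK⟩ := exists_gramMat_mulVec_lipschitz M hg2 (‖q₀‖ + 1)
  obtain ⟨c, hc, ha⟩ := ha.exists_pos
  obtain ⟨d, hd, hq⟩ := hq.exists_pos
  have ht : Tendsto (fun t : ℝ => t) (𝓝[Icc 0 T] 0) (𝓝 0) :=
    tendsto_id.mono_left nhdsWithin_le_nhds
  have e1 : ∀ᶠ t : ℝ in 𝓝[Icc 0 T] 0, d * t ≤ 1 := by
    have := ht.const_mul d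
    rw [mul_zero] at this
    exact this.eventually_le_const one_pos
  -- Only the Gram matrix at q₀ is inverted; for such t the error of freezing it there is absorbed
  -- into the left-hand side, which produces the final factor 2.
  have e2 : ∀ᶠ t : ℝ in 𝓝[Icc 0 T] 0, β * (K * d) * t ≤ 1 / 2 := by
    have := ht.const_mul (β * (K * d))
    rw [mul_zero] at this
    exact this.eventually_le_const (by norm_num)
  refine IsBigO.of_bound (2 * β * c) ?_
  filter_upwards [ha.bound, hq.bound, e1, e2, self_mem_nhdsWithin] with t h1 h2 h3 h4 ht
  rw [Real.norm_of_nonneg ht.1] at h1 h2 ⊢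
  have h5 := accel_sub_accel M U g (q t) (p t) (Λ t) lam
  rw [H.accel_eq_zero hg2 hT ht, zero_sub, neg_inj] at h5
  have h6 := hK q₀ (by simp) (q t) (by
    rw [mem_closedBall_zero_iff]
    calc ‖q t‖ = ‖q₀ + (q t - q₀)‖ := by rw [add_sub_cancel]
      _ ≤ _ := (norm_add_le _ _).trans (by linarith)) (Λ t - lam)
  rw [← h5] at h6
  have h7 : ‖gramMat M g q₀ *ᵥ (Λ t - lam)‖ ≤ K * (d * t) * ‖Λ t - lam‖ + c * t := by
    calc _ = ‖(gramMat M g q₀ *ᵥ (Λ t - lam) - accel M U g (q t) (p t) lam) +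
          accel M U g (q t) (p t) lam‖ := by rw [sub_add_cancel]
      _ ≤ _ := by
        refine (norm_add_le _ _).trans (add_le_add (h6.trans ?_) h1)
        rw [norm_sub_rev]
        gcongr
  have h8 := hβ (gramMat M g q₀ *ᵥ (Λ t - lam))
  rw [gramMat_inv_mulVec hreg] at h8
  have h9 := h8.trans (mul_le_mul_of_nonneg_left h7 hβ0.le)
  have h10 := mul_le_mul_of_nonneg_right h4 (norm_nonneg (Λ t - lam))
  nlinarith

theorem IsConstrainedMotion.taylor_isBigO (H : IsConstrainedMotion M U g q₀ p₀ T Λ q p)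
    (hU : ContDiff ℝ 2 U) (hg : ContDiff ℝ 3 g) (hreg : IsUnit (gramMat M g q₀)) (hT : 0 < T) :
    ((fun h => q h - q₀ - h • (M⁻¹ *ᵥ p₀)) =O[𝓝[>] 0] fun h : ℝ => h ^ 2) ∧
      (fun h => p h - p₀ - h • force U g q₀ (multiplier M U g q₀ p₀)) =O[𝓝[>] 0]
        fun h : ℝ => h ^ 2 := by
  have hΛ := H.multiplier_isBigO hU hg hreg hT
  obtain ⟨hq, hp⟩ := H.motion.isBigO_sub hT
  constructor
  · refine isBigO_sq_of_hasDerivWithinAt hT (fun s hs => ((H.motion.deriv_pos s hs).sub_const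
      q₀).sub (hasDerivWithinAt_id_smul _ _ s)) (by simp [H.motion.init_pos]) ?_
    exact isBigO_comp_sub (contDiff_mulVec M⁻¹) hp
  · refine isBigO_sq_of_hasDerivWithinAt hT (fun s hs => ((H.motion.deriv_mom s hs).sub_const
      p₀).sub (hasDerivWithinAt_id_smul _ _ s)) (by simp [H.motion.init_mom]) ?_
    exact isBigO_comp_sub (z := fun t => (q t, Λ t)) (z₀ := (q₀, multiplier M U g q₀ p₀))
      (contDiff_force hU (hg.of_le (by norm_num))) (hq.prod_left hΛ)

end Constrained

end

/-! ### Expansion of the numerical step and the main theorem. -/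

section

variable {m ν : ℕ} {M : Matrix (Fin m) (Fin m) ℝ} {U : (Fin m → ℝ) → ℝ}
  {g : (Fin m → ℝ) → (Fin ν → ℝ)} {q₀ p₀ : Fin m → ℝ}

theorem force_sub_force (U : (Fin m → ℝ) → ℝ) (g : (Fin m → ℝ) → (Fin ν → ℝ)) (q : Fin m → ℝ)
    (l l' : Fin ν → ℝ) : force U g q l - force U g q l' = -(gradMat g q *ᵥ (l - l')) := by
  rw [force, force, Matrix.mulVec_sub]
  abel

theorem isBigO_mulVec {n k : ℕ} (A : Matrix (Fin n) (Fin k) ℝ) (w : ℝ → Fin k → ℝ)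
    (l : Filter ℝ) : (fun h => A *ᵥ w h) =O[l] w := by
  obtain ⟨β, -, hβ⟩ := exists_norm_mulVec_le A
  exact IsBigO.of_bound β (Eventually.of_forall fun h => hβ (w h))

/-- The multiplier enters the first-order terms of momentum and `hidden` with a factor h, so
replacing `lam h` by its O(h)-close limit costs O(h²). At that limit the first-order term of
`hidden` vanishes. -/
theorem IsLocalFlow.step_isBigO {R ε C : ℝ} {u v : (Fin ν → ℝ) → ℝ → (Fin m → ℝ)}
    {lam : ℝ → Fin ν → ℝ} (H : IsLocalFlow M U g q₀ p₀ R ε C u v) (hε : 0 < ε)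
    (hreg : IsUnit (gramMat M g q₀)) (hlam : ∀ᶠ h in 𝓝[>] (0 : ℝ), ‖lam h‖ ≤ R)
    (hO : (fun h => lam h - multiplier M U g q₀ p₀) =O[𝓝[>] 0] fun h : ℝ => h) :
    ((fun h => u (lam h) h - q₀ - h • (M⁻¹ *ᵥ p₀)) =O[𝓝[>] 0] fun h : ℝ => h ^ 2) ∧
    ((fun h => v (lam h) h - p₀ - h • force U g q₀ (multiplier M U g q₀ p₀)) =O[𝓝[>] 0]
      fun h : ℝ => h ^ 2) ∧
    (fun h => hidden M g (u (lam h) h) (v (lam h) h)) =O[𝓝[>] 0] fun h : ℝ => h ^ 2 := by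
  have hId : (fun h : ℝ => h) =O[𝓝[>] 0] fun h : ℝ => h := isBigO_refl _ _
  have hsm : ∀ {F : Type} [NormedAddCommGroup F] [NormedSpace ℝ F] (w : ℝ → F),
      (w =O[𝓝[>] 0] fun h : ℝ => h) → (fun h => h • w h) =O[𝓝[>] 0] fun h : ℝ => h ^ 2 := by
    intro F _ _ w hw
    simpa [smul_eq_mul, pow_two] using hId.smul hw
  have hsmall : ∀ᶠ h in 𝓝[>] (0 : ℝ), h ∈ Icc 0 ε := by
    filter_upwards [Ioc_mem_nhdsGT hε] with h hh using Ioc_subset_Icc_self hh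
  refine ⟨IsBigO.of_bound C ?_, ?_, ?_⟩
  · filter_upwards [hlam, hsmall] with h h1 h2
    rw [Real.norm_of_nonneg (by positivity)]
    exact H.pos_le _ h1 h h2
  · have h1 : (fun h => v (lam h) h - p₀ - h • force U g q₀ (lam h)) =O[𝓝[>] 0]
        fun h : ℝ => h ^ 2 := by
      refine IsBigO.of_bound C ?_
      filter_upwards [hlam, hsmall] with h h1 h2
      rw [Real.norm_of_nonneg (by positivity)]
      exact H.mom_le _ h1 h h2
    have h2 := hsm _ (((isBigO_mulVec (gradMat g q₀) _ _).trans hO).neg_left)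
    refine (h1.add h2).congr_left fun h => ?_
    rw [← force_sub_force U, smul_sub]
    abel
  · have h1 : (fun h => hidden M g (u (lam h) h) (v (lam h) h) -
        h • accel M U g q₀ p₀ (lam h)) =O[𝓝[>] 0] fun h : ℝ => h ^ 2 := by
      refine IsBigO.of_bound C ?_
      filter_upwards [hlam, hsmall] with h h1 h2
      rw [Real.norm_of_nonneg (by positivity)]
      exact H.hidden_le _ h1 h h2
    have h2 := hsm _ (((isBigO_mulVec (gramMat M g q₀) _ _).trans hO).neg_left)
    refine (h1.add h2).congr_left fun h => ?_
    rw [← accel_sub_accel M U g q₀ p₀, accel_multiplier hreg, sub_zero, sub_add_cancel]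

theorem eventually_mul_le_half (c : ℝ) : ∀ᶠ h : ℝ in 𝓝[>] 0, c * h ≤ 1 / 2 := by
  have ht : Tendsto (fun h : ℝ => c * h) (𝓝[>] 0) (𝓝 (c * 0)) :=
    (tendsto_id.mono_left nhdsWithin_le_nhds).const_mul c
  rw [mul_zero] at ht
  exact ht.eventually_le_const (by norm_num)

end

end HolonomicLIM

end

theorem theorem4 {m ν : ℕ} (M : Matrix (Fin m) (Fin m) ℝ) (hM : M.PosDef)
    (U : (Fin m → ℝ) → ℝ) (hU : AnalyticOnNhd ℝ U Set.univ)
    (g : (Fin m → ℝ) → (Fin ν → ℝ)) (hg : AnalyticOnNhd ℝ g Set.univ)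
    (q₀ p₀ : Fin m → ℝ)
    (hreg : IsUnit (HolonomicLIM.gramMat M g q₀))
    (hq₀ : g q₀ = 0)
    (hp₀ : HolonomicLIM.hidden M g q₀ p₀ = 0) :
    ∃ (lam₀ : ℝ → (Fin ν → ℝ)) (q₁ p₁ : ℝ → (Fin m → ℝ)),
      -- existence, the constraint and the energy after one step
      (∀ᶠ h in 𝓝[>] (0 : ℝ),
        HolonomicLIM.IsOneStep M U g q₀ p₀ h (lam₀ h) (q₁ h) (p₁ h) ∧
        g (q₁ h) = 0 ∧
        HolonomicLIM.hamiltonian M U (q₁ h) (p₁ h) = HolonomicLIM.hamiltonian M U q₀ p₀) ∧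
      -- uniqueness of the multiplier (and of the resulting step) in every bounded set
      (∀ R : ℝ, ∀ᶠ h in 𝓝[>] (0 : ℝ), ∀ (l : Fin ν → ℝ) (q' p' : Fin m → ℝ),
        ‖l‖ ≤ R → HolonomicLIM.IsOneStep M U g q₀ p₀ h l q' p' → g q' = 0 →
          l = lam₀ h ∧ q' = q₁ h ∧ p' = p₁ h) ∧
      -- the multiplier
      (fun h => lam₀ h - HolonomicLIM.multiplier M U g q₀ p₀) =O[𝓝[>] (0 : ℝ)]
        (fun h : ℝ => h) ∧
      -- the one-step errors with respect to the solution of the constrained problem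
      (∀ (T : ℝ) (Λ : ℝ → (Fin ν → ℝ)) (q p : ℝ → (Fin m → ℝ)), 0 < T →
        HolonomicLIM.IsConstrainedMotion M U g q₀ p₀ T Λ q p →
          (fun h => q₁ h - q h) =O[𝓝[>] (0 : ℝ)] (fun h : ℝ => h ^ 2) ∧
          (fun h => p₁ h - p h) =O[𝓝[>] (0 : ℝ)] (fun h : ℝ => h ^ 2)) ∧
      -- the hidden constraint
      (fun h => HolonomicLIM.hidden M g (q₁ h) (p₁ h)) =O[𝓝[>] (0 : ℝ)]
        (fun h : ℝ => h ^ 2) := by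
  open HolonomicLIM in
  have hU2 : ContDiff ℝ 2 U := hU.contDiff
  have hg3 : ContDiff ℝ 3 g := hg.contDiff
  have hg2 : ContDiff ℝ 2 g := hg.contDiff
  have hsymm : M.IsSymm := by
    have := hM.isHermitian
    rwa [Matrix.IsHermitian, Matrix.conjTranspose_eq_transpose_of_trivial] at this
  obtain ⟨β, hβ0, hβ⟩ := exists_norm_mulVec_le (gramMat M g q₀)⁻¹
  obtain ⟨ε, hε, C, hC, u, v, H⟩ := exists_isLocalFlow M hU2 hg3 hq₀ hp₀
    (R := ‖multiplier M U g q₀ p₀‖ + 1) (by positivity)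
  -- Stated for every h so that a total function can be chosen; outside the admissible range its
  -- value 0 is irrelevant.
  have hex : ∀ h : ℝ, ∃ l, 0 < h → h ≤ ε → 2 * β * C * h ≤ 1 / 2 →
      ‖l‖ ≤ ‖multiplier M U g q₀ p₀‖ + 1 ∧ g (u l h) = 0 ∧
      ‖l - multiplier M U g q₀ p₀‖ ≤ 4 * β * C * h := by
    intro h
    by_cases hh : 0 < h ∧ h ≤ ε ∧ 2 * β * C * h ≤ 1 / 2
    · obtain ⟨l, hl⟩ := H.exists_multiplier hreg hβ hβ0.le hh.1 hh.2.1 hh.2.2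
      exact ⟨l, fun _ _ _ => hl⟩
    · exact ⟨0, fun h1 h2 h3 => absurd ⟨h1, h2, h3⟩ hh⟩
  choose lam hlam using hex
  have hev : ∀ᶠ h in 𝓝[>] (0 : ℝ), 0 < h ∧ h ≤ ε ∧
      ‖lam h‖ ≤ ‖multiplier M U g q₀ p₀‖ + 1 ∧ g (u (lam h) h) = 0 ∧
      ‖lam h - multiplier M U g q₀ p₀‖ ≤ 4 * β * C * h := by
    filter_upwards [Ioc_mem_nhdsGT hε, eventually_mul_le_half (2 * β * C)] with h h1 h2
    exact ⟨h1.1, h1.2, hlam h h1.1 h1.2 h2⟩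
  have hO : (fun h => lam h - multiplier M U g q₀ p₀) =O[𝓝[>] 0] fun h : ℝ => h := by
    refine IsBigO.of_bound (4 * β * C) ?_
    filter_upwards [hev] with h hh
    rw [Real.norm_of_nonneg hh.1.le]
    exact hh.2.2.2.2
  obtain ⟨hq, hp, hhid⟩ := H.step_isBigO hε hreg (hev.mono fun h hh => hh.2.2.1) hO
  refine ⟨lam, fun h => u (lam h) h, fun h => v (lam h) h, ?_, fun R => ?_, hO, ?_, hhid⟩
  · filter_upwards [hev] with h ⟨h0, hhε, hl, hz, _⟩
    have hmot := (H.motion _ hl).mono hhε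
    refine ⟨⟨_, _, hmot, rfl, rfl⟩, hz, ?_⟩
    have := hmot.hamiltonian_add_constraint hsymm (hU2.differentiable (by norm_num)) hg2 h0.le
    simpa [hz, hq₀] using this
  -- A second flow covers both the given R and the bound on `lam h`; its ε' and C' make the
  -- threshold for h depend on R. Uniqueness of solutions transfers both zeros of g to this flow.
  · obtain ⟨ε', hε', C', hC', u', v', H'⟩ := exists_isLocalFlow M hU2 hg3 hq₀ hp₀
      (R := max R (‖multiplier M U g q₀ p₀‖ + 1)) (le_max_of_le_right (by positivity))
    filter_upwards [hev, Ioc_mem_nhdsGT hε', eventually_mul_le_half (2 * β * C')]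
      with h ⟨h0, hhε, hl, hz, _⟩ hε'h hs l q' p' hlR ⟨x, y, hxy, hx, hy⟩ hzq
    have hlR' : ‖l‖ ≤ max R (‖multiplier M U g q₀ p₀‖ + 1) := hlR.trans (le_max_left _ _)
    have hl' : ‖lam h‖ ≤ max R (‖multiplier M U g q₀ p₀‖ + 1) := hl.trans (le_max_right _ _)
    have hmem : h ∈ Icc 0 h := ⟨h0.le, le_rfl⟩
    have e1 := (hxy.eqOn ((H'.motion l hlR').mono hε'h.2) hU2 hg2).1 hmem
    have e2 := (((H.motion _ hl).mono hhε).eqOn ((H'.motion _ hl').mono hε'h.2) hU2 hg2).1 hmem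
    have hll : l = lam h := H'.multiplier_unique hreg hβ hβ0.le h0 hε'h.2 hs hlR' hl'
      (by rw [← e1, hx, hzq]) (by rw [← e2, hz])
    subst hll
    have e3 := hxy.eqOn ((H.motion _ hl).mono hhε) hU2 hg2
    exact ⟨rfl, hx.symm.trans (e3.1 hmem), hy.symm.trans (e3.2 hmem)⟩
  · intro T Λ q p hT Hc
    obtain ⟨hq', hp'⟩ := Hc.taylor_isBigO hU2 hg3 hreg hT
    -- The step and the exact solution share their terms up to order h, so these cancel.
    exact ⟨(hq.sub hq').congr_left fun h => by abel, (hp.sub hp').congr_left fun h => by abel⟩
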